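/- The *grid* is the graph on $\mathbb{Z}\times\mathbb{Z}$ whose edges are the pairs of points at distance one; an edge is vertical if its two points have the same first coordinate, and horizontal if they have the same second coordinate. A *path* in the grid is a simple path with at least one edge, and a *bend* of a path is a pair of consecutive edges of the path with different directions. For an integer $k\ge 0$, a *$B_k$-EPG representation* of a finite simple graph $G$ assigns to each vertex $v$ of $G$ a path $P_v$ in the grid with at most $k$ bends, such that two distinct vertices $u,v$ are adjacent in $G$ if and only if $P_u$ and $P_v$ have a common edge. The representation is *Helly* if the collection of edge sets of the paths $P_v$ has the Helly property, that is, every nonempty subcollection whose members pairwise intersect has a common edge. Let $B_k$-EPG (respectively Helly-$B_k$-EPG) be the class of finite simple graphs that admit a $B_k$-EPG representation (respectively a Helly $B_k$-EPG representation). Then for every integer $k>0$, the class Helly-$B_k$-EPG is a proper subclass of $B_k$-EPG: $$\text{Helly-}B_k\text{-EPG}\subsetneq B_k\text{-EPG}.$$ -/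

import Mathlib

universe u

namespace EPG

/-- The (infinite) rectangular grid: its points are the pairs of integers, and its edges
are the pairs of points at distance one. -/
def grid : SimpleGraph (ℤ × ℤ) where
  Adj p q := |p.1 - q.1| + |p.2 - q.2| = 1
  symm := ⟨fun p q h => by rwa [abs_sub_comm q.1, abs_sub_comm q.2]⟩
  loopless := ⟨fun p h => by simp at h⟩

/-- A simple path of the grid, with at least one edge. For grid edges, being a walk without
repeated points is the same as being a sequence of distinct edges in which consecutive edges
share a point and non-consecutive edges share none. -/
structure GridPath where
  source : ℤ × ℤ
  target : ℤ × ℤ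
  walk : grid.Walk source target
  isPath : walk.IsPath
  length_pos : 0 < walk.length

namespace GridPath

/-- The set of edges of the grid that the path uses. -/
def edgeSet (P : GridPath) : Set (Sym2 (ℤ × ℤ)) :=
  {e | e ∈ P.walk.edges}

/-- The `i`-th edge of the path (from the `i`-th to the `(i+1)`-st point) is vertical: its two
points have the same first coordinate. An edge of the grid that is not vertical is horizontal. -/
abbrev IsVerticalEdge (P : GridPath) (i : ℕ) : Prop :=
  (P.walk.getVert i).1 = (P.walk.getVert (i + 1)).1

/-- The number of bends: the number of pairs of consecutive edges (edges `i` and `i + 1`, for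
`0 ≤ i` and `i + 1 < length`) with different directions. -/
def bends (P : GridPath) : ℕ :=
  ((Finset.range (P.walk.length - 1)).filter
    fun i => ¬ (P.IsVerticalEdge i ↔ P.IsVerticalEdge (i + 1))).card

end GridPath

/-- A collection of sets has the Helly property when every (nonempty) pairwise intersecting
subcollection has a common element. -/
def HellyProperty {α : Type*} (C : Set (Set α)) : Prop :=
  ∀ C' : Set (Set α), C' ⊆ C → C'.Nonempty →
    (C'.Pairwise fun A B => (A ∩ B).Nonempty) → (⋂₀ C').Nonempty

/-- An EPG representation of a graph: a path of the grid for each vertex, such that two distinct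
vertices are adjacent if and only if their paths have a common edge. -/
structure Representation {V : Type*} (G : SimpleGraph V) where
  path : V → GridPath
  adj_iff : ∀ u v : V, u ≠ v →
    (G.Adj u v ↔ ((path u).edgeSet ∩ (path v).edgeSet).Nonempty)

namespace Representation

/-- Every path of the representation has at most `k` bends. -/
def IsB {V : Type*} {G : SimpleGraph V} (R : Representation G) (k : ℕ) : Prop :=
  ∀ v : V, (R.path v).bends ≤ k

/-- The edge sets of the paths of the representation have the Helly property. -/
def IsHelly {V : Type*} {G : SimpleGraph V} (R : Representation G) : Prop :=
  HellyProperty (Set.range fun v : V => (R.path v).edgeSet)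

end Representation

/-- A finite simple graph. -/
structure FiniteGraph : Type (u + 1) where
  V : Type u
  finite : Finite V
  graph : SimpleGraph V

/-- The class `B_k`-EPG. -/
def BkEPG (k : ℕ) : Set FiniteGraph.{u} :=
  {G | ∃ R : Representation G.graph, R.IsB k}

/-- The class Helly-`B_k`-EPG. -/
def HellyBkEPG (k : ℕ) : Set FiniteGraph.{u} :=
  {G | ∃ R : Representation G.graph, R.IsB k ∧ R.IsHelly}

end EPG

/-!
For each `k` a cocktail party graph (the complement of a perfect matching on `2 * n` vertices)
separates the two classes. It has `2 ^ n` maximal cliques, obtained by taking one vertex from each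
couple. In a Helly representation all of them must be realised by grid edges, and these edges
are distinct, since the two paths of a couple share no edge.

* If `2 ≤ k`, every cocktail party graph has a representation by `U`-shaped paths with two bends
  (`EPG.cocktailParty_mem_BkEPG_two`). On the other hand, an edge that realises a maximal clique can
  be slid along its grid line until one of the paths of the clique is about to end its straight run.
  A path with at most `k` bends has at most `2 * k + 2` such edges, so a Helly representation
  forces `2 ^ n ≤ 2 * n * (2 * k + 2)` (`EPG.two_pow_le_of_helly`), which is false for large `n`.

* If `k = 1`, the octahedron (`n = 3`) is represented by the six paths of length two through one
  point of the grid (`EPG.octahedron_mem_BkEPG_one`). Paths with at most one bend are `L`-shaped, and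
  two of them that share an edge meet in an interval of each (`EPG.GridPath.exists_position`). In a
  Helly representation, one path would contain four edges indexed by the elements of
  `Bool × Bool`, such that the two edges with a given first entry are not separated by another
  edge of the four, and likewise for the second entry. No linear order of the four has both
  properties (`EPG.octahedron_notMem_HellyBkEPG_one`).
-/

namespace EPG

/-! ### Edges and paths of the grid -/

/-- The grid edge at position `x` of a grid line: the horizontal edge from `(x, y)` to `(x + 1, y)`
if `b = true`, and the vertical edge from `(y, x)` to `(y, x + 1)` if `b = false`. -/
def edgeAt : Bool → ℤ → ℤ → Sym2 (ℤ × ℤ)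
  | true, x, y => s((x, y), (x + 1, y))
  | false, x, y => s((y, x), (y, x + 1))

theorem edgeAt_inj {b c : Bool} {x y z w : ℤ} :
    edgeAt b x y = edgeAt c z w ↔ b = c ∧ x = z ∧ y = w := by
  cases b <;> cases c <;> simp only [edgeAt, Sym2.eq_iff, Prod.mk.injEq] <;> simp <;> omega

theorem grid_adj_iff {p q : ℤ × ℤ} :
    grid.Adj p q ↔ (p.2 = q.2 ∧ (q.1 = p.1 + 1 ∨ p.1 = q.1 + 1)) ∨
      (p.1 = q.1 ∧ (q.2 = p.2 + 1 ∨ p.2 = q.2 + 1)) := by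
  change |p.1 - q.1| + |p.2 - q.2| = 1 ↔ _
  rcases abs_cases (p.1 - q.1) with h | h <;> rcases abs_cases (p.2 - q.2) with h' | h' <;> omega

theorem mk_eq_edgeAt_true {p q : ℤ × ℤ} {x y : ℤ} :
    s(p, q) = edgeAt true x y ↔
      p.2 = y ∧ q.2 = y ∧ ((p.1 = x ∧ q.1 = x + 1) ∨ (q.1 = x ∧ p.1 = x + 1)) := by
  obtain ⟨a, b⟩ := p
  obtain ⟨c, d⟩ := q
  simp only [edgeAt, Sym2.eq_iff, Prod.mk.injEq]
  omega

theorem mk_eq_edgeAt_false {p q : ℤ × ℤ} {x y : ℤ} :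
    s(p, q) = edgeAt false x y ↔
      p.1 = y ∧ q.1 = y ∧ ((p.2 = x ∧ q.2 = x + 1) ∨ (q.2 = x ∧ p.2 = x + 1)) := by
  obtain ⟨a, b⟩ := p
  obtain ⟨c, d⟩ := q
  simp only [edgeAt, Sym2.eq_iff, Prod.mk.injEq]
  omega

theorem exists_edgeAt_of_adj {p q : ℤ × ℤ} (h : grid.Adj p q) :
    ∃ b x y, s(p, q) = edgeAt b x y := by
  rcases grid_adj_iff.1 h with ⟨h1, h2 | h2⟩ | ⟨h1, h2 | h2⟩
  · exact ⟨true, p.1, p.2, mk_eq_edgeAt_true.2 (by omega)⟩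
  · exact ⟨true, q.1, p.2, mk_eq_edgeAt_true.2 (by omega)⟩
  · exact ⟨false, p.2, p.1, mk_eq_edgeAt_false.2 (by omega)⟩
  · exact ⟨false, q.2, p.1, mk_eq_edgeAt_false.2 (by omega)⟩

namespace GridPath

theorem mem_edgeSet_iff (P : GridPath) (e : Sym2 (ℤ × ℤ)) :
    e ∈ P.edgeSet ↔
      ∃ t < P.walk.length, s(P.walk.getVert t, P.walk.getVert (t + 1)) = e := by
  change e ∈ P.walk.edges ↔ _
  rw [SimpleGraph.Walk.edges, List.mem_map]
  simp only [List.mem_iff_getElem]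
  constructor
  · rintro ⟨d, ⟨t, ht, rfl⟩, rfl⟩
    refine ⟨t, by simpa using ht, ?_⟩
    rw [SimpleGraph.Walk.darts_getElem_eq_getVert]
    rfl
  · rintro ⟨t, ht, rfl⟩
    refine ⟨_, ⟨t, by simpa using ht, rfl⟩, ?_⟩
    rw [SimpleGraph.Walk.darts_getElem_eq_getVert]
    rfl

theorem edgeSet_finite (P : GridPath) : P.edgeSet.Finite :=
  P.walk.edges.finite_toSet

theorem exists_edgeAt_of_mem {P : GridPath} {e : Sym2 (ℤ × ℤ)} (h : e ∈ P.edgeSet) :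
    ∃ b x y, e = edgeAt b x y := by
  obtain ⟨t, ht, rfl⟩ := (P.mem_edgeSet_iff e).1 h
  exact exists_edgeAt_of_adj (P.walk.adj_getVert_succ ht)

/-- Where a path does not bend it goes straight on: it cannot turn back, being simple. -/
theorem getVert_add_two (P : GridPath) {t : ℕ} (ht : t + 1 < P.walk.length)
    (h : P.IsVerticalEdge t ↔ P.IsVerticalEdge (t + 1)) :
    P.walk.getVert (t + 2) - P.walk.getVert (t + 1) =
      P.walk.getVert (t + 1) - P.walk.getVert t := by
  have h1 := grid_adj_iff.1 (P.walk.adj_getVert_succ (i := t) (by omega))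
  have h2 := grid_adj_iff.1 (P.walk.adj_getVert_succ ht)
  have h3 : P.walk.getVert t ≠ P.walk.getVert (t + 2) := fun h =>
    absurd (P.isPath.getVert_injOn (by simp; omega) (by simp; omega) h) (by omega)
  unfold IsVerticalEdge at h
  rw [show t + 1 + 1 = t + 2 from rfl] at *
  generalize P.walk.getVert t = p at *
  generalize P.walk.getVert (t + 1) = q at *
  generalize P.walk.getVert (t + 2) = r at *
  rw [Ne, Prod.ext_iff] at h3
  ext <;> simp only [Prod.fst_sub, Prod.snd_sub] <;> omega

/-- A sequence of points of the grid with adjacent consecutive terms is traced by a walk. -/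
theorem exists_walk (L : ℕ) (p : ℕ → ℤ × ℤ) (h : ∀ t < L, grid.Adj (p t) (p (t + 1))) :
    ∃ w : grid.Walk (p 0) (p L), w.length = L ∧ ∀ t ≤ L, w.getVert t = p t := by
  induction L generalizing p with
  | zero => exact ⟨.nil, rfl, fun t ht => by obtain rfl : t = 0 := by omega
                                             rfl⟩
  | succ L ih =>
    obtain ⟨w, hw, hp⟩ := ih (fun t => p (t + 1)) fun t ht => h (t + 1) (by omega)
    refine ⟨.cons (h 0 (by omega)) w, by simp [hw], fun t ht => ?_⟩
    cases t with
    | zero => rfl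
    | succ t => simpa using hp t (by omega)

theorem exists_gridPath (L : ℕ) (hL : 0 < L) (p : ℕ → ℤ × ℤ)
    (h : ∀ t < L, grid.Adj (p t) (p (t + 1)))
    (hinj : ∀ s t, s ≤ L → t ≤ L → p s = p t → s = t) :
    ∃ P : GridPath, P.walk.length = L ∧ ∀ t ≤ L, P.walk.getVert t = p t := by
  obtain ⟨w, hw, hp⟩ := exists_walk L p h
  refine ⟨⟨_, _, w, ?_, by omega⟩, hw, hp⟩
  rw [← SimpleGraph.Walk.IsPath.getVert_injOn_iff]
  intro s hs t ht hst
  simp only [Set.mem_ofPred_eq, hw] at hs ht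
  rw [hp s hs, hp t ht] at hst
  exact hinj s t hs ht hst

end GridPath

/-! ### Run starts of a path -/

/-- The set of edges of `P` at which a maximal straight piece of `P` begins, when the grid line
that carries the piece is traversed in the positive direction. -/
def GridPath.runStarts (P : GridPath) : Set (Sym2 (ℤ × ℤ)) :=
  {e | ∃ b x y, e = edgeAt b x y ∧ edgeAt b x y ∈ P.edgeSet ∧ edgeAt b (x - 1) y ∉ P.edgeSet}

/-- A run start is the first or the last edge of the path, or one of the two edges of a bend. -/
theorem GridPath.exists_runStarts_subset (P : GridPath) :
    ∃ F : Finset (Sym2 (ℤ × ℤ)), P.runStarts ⊆ ↑F ∧ F.card ≤ 2 * P.bends + 2 := by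
  classical
  set B := (Finset.range (P.walk.length - 1)).filter
    fun i => ¬ (P.IsVerticalEdge i ↔ P.IsVerticalEdge (i + 1)) with hB
  refine ⟨(({0, P.walk.length - 1} : Finset ℕ) ∪ (B ∪ B.image (· + 1))).image
    fun t => s(P.walk.getVert t, P.walk.getVert (t + 1)), ?_, ?_⟩
  · rintro _ ⟨b, x, y, rfl, hmem, hnot⟩
    obtain ⟨t, ht, hte⟩ := (P.mem_edgeSet_iff _).1 hmem
    simp only [Finset.coe_image, Set.mem_image, Finset.mem_coe]
    refine ⟨t, ?_, hte⟩
    by_contra hcon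
    simp only [Finset.mem_union, Finset.mem_insert, Finset.mem_singleton, Finset.mem_image,
      not_or, not_exists, not_and] at hcon
    obtain ⟨⟨h0, h1⟩, h2, h3⟩ := hcon
    obtain ⟨s, rfl⟩ : ∃ s, t = s + 1 := ⟨t - 1, by omega⟩
    have hs : P.IsVerticalEdge s ↔ P.IsVerticalEdge (s + 1) := by
      by_contra h
      exact h3 s (by simp only [hB, Finset.mem_filter, Finset.mem_range]; exact ⟨by omega, h⟩) rfl
    have hs' : P.IsVerticalEdge (s + 1) ↔ P.IsVerticalEdge (s + 1 + 1) := by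
      by_contra h
      exact h2 (by simp only [hB, Finset.mem_filter, Finset.mem_range]; exact ⟨by omega, h⟩)
    -- the edges before and after are collinear, and one of them is the previous edge of the line
    have e1 := Prod.ext_iff.1 (P.getVert_add_two (t := s) (by omega) hs)
    have e2 := Prod.ext_iff.1 (P.getVert_add_two (t := s + 1) (by omega) hs')
    have m1 : s(P.walk.getVert s, P.walk.getVert (s + 1)) ≠ edgeAt b (x - 1) y := fun h =>
      hnot ((P.mem_edgeSet_iff _).2 ⟨s, by omega, h⟩)
    have m2 : s(P.walk.getVert (s + 2), P.walk.getVert (s + 3)) ≠ edgeAt b (x - 1) y := fun h =>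
      hnot ((P.mem_edgeSet_iff _).2 ⟨s + 2, by omega, h⟩)
    simp only [Prod.fst_sub, Prod.snd_sub, add_assoc, Nat.reduceAdd] at e1 e2 hte
    generalize P.walk.getVert s = p at *
    generalize P.walk.getVert (s + 1) = q at *
    generalize P.walk.getVert (s + 2) = r at *
    generalize P.walk.getVert (s + 3) = v at *
    cases b
    · rw [Ne, mk_eq_edgeAt_false] at m1 m2
      rw [mk_eq_edgeAt_false] at hte
      omega
    · rw [Ne, mk_eq_edgeAt_true] at m1 m2
      rw [mk_eq_edgeAt_true] at hte
      omega
  · have h1 : (B.image (· + 1)).card ≤ B.card := Finset.card_image_le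
    have h2 : B.card = P.bends := rfl
    have h3 := Finset.card_union_le B (B.image (· + 1))
    have h4 := Finset.card_union_le ({0, P.walk.length - 1} : Finset ℕ) (B ∪ B.image (· + 1))
    have h5 : ({0, P.walk.length - 1} : Finset ℕ).card ≤ 2 := Finset.card_le_two
    refine Finset.card_image_le.trans ?_
    omega

/-! ### Cocktail party graphs -/

/-- The cocktail party graph on `n` couples: the `i`-th couple is `(i, false)`, `(i, true)`, and two
vertices are adjacent when they belong to different couples. -/
def cocktailParty (n : ℕ) : FiniteGraph.{u} where
  V := ULift.{u} (Fin n × Bool)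
  finite := inferInstance
  graph :=
    { Adj := fun v w => v.down.1 ≠ w.down.1
      symm := ⟨fun _ _ h => h.symm⟩
      loopless := ⟨fun _ h => h rfl⟩ }

/-- A family of paths represents the cocktail party graph if the paths of different couples share an
edge and the two paths of a couple do not. -/
theorem cocktailParty_mem_BkEPG {n k : ℕ} (P : Fin n → Bool → GridPath)
    (hb : ∀ i b, (P i b).bends ≤ k)
    (hd : ∀ i, Disjoint (P i false).edgeSet (P i true).edgeSet)
    (hm : ∀ i j b c, i < j → ((P i b).edgeSet ∩ (P j c).edgeSet).Nonempty) :
    cocktailParty.{u} n ∈ BkEPG.{u} k := by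
  refine ⟨⟨fun v => P v.down.1 v.down.2, ?_⟩, fun v => hb _ _⟩
  rintro ⟨i, b⟩ ⟨j, c⟩ hne
  change i ≠ j ↔ ((P i b).edgeSet ∩ (P j c).edgeSet).Nonempty
  rcases lt_trichotomy i j with h | rfl | h
  · exact iff_of_true h.ne (hm i j b c h)
  · refine iff_of_false (by simp) ?_
    rw [Set.not_nonempty_iff_eq_empty, ← Set.disjoint_iff_inter_eq_empty]
    cases b <;> cases c
    · exact absurd rfl hne
    · exact hd i
    · exact (hd i).symm
    · exact absurd rfl hne
  · exact iff_of_true h.ne' (by rw [Set.inter_comm]; exact hm j i c b h)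

/-- In a Helly representation of the cocktail party graph, each of the `2 ^ n` maximal cliques
(one vertex of each couple) has an edge of the grid that lies on all paths of the clique. Since the
two paths of a couple are disjoint, it lies on no other path. -/
theorem exists_edge_of_helly {n k : ℕ} (hn : 0 < n)
    (h : cocktailParty.{u} n ∈ HellyBkEPG.{u} k) :
    ∃ P : Fin n → Bool → GridPath, (∀ i b, (P i b).bends ≤ k) ∧
      (∀ i, Disjoint (P i false).edgeSet (P i true).edgeSet) ∧
      ∀ S : Fin n → Bool, ∃ e, ∀ i, e ∈ (P i (S i)).edgeSet := by
  obtain ⟨R, hR, hH⟩ := h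
  let P : Fin n → Bool → GridPath := fun i b => R.path ⟨i, b⟩
  refine ⟨P, fun i b => hR _, fun i => ?_, fun S => ?_⟩
  · have := (R.adj_iff ⟨i, false⟩ ⟨i, true⟩ fun h =>
      Bool.false_ne_true (congrArg (fun v : ULift.{u} (Fin n × Bool) => v.down.2) h)).not.1
      fun h => h rfl
    rwa [Set.not_nonempty_iff_eq_empty, ← Set.disjoint_iff_inter_eq_empty] at this
  · obtain ⟨e, he⟩ := hH (Set.range fun i => (P i (S i)).edgeSet)
      (by rintro _ ⟨i, rfl⟩; exact ⟨⟨i, S i⟩, rfl⟩) ⟨_, ⟨0, hn⟩, rfl⟩ (by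
        rintro _ ⟨i, rfl⟩ _ ⟨j, rfl⟩ hne
        have hij : i ≠ j := by rintro rfl; exact hne rfl
        exact (R.adj_iff ⟨i, S i⟩ ⟨j, S j⟩ fun h =>
          hij (congrArg (fun v : ULift.{u} (Fin n × Bool) => v.down.1) h)).1 hij)
    exact ⟨e, fun i => he _ ⟨i, rfl⟩⟩

/-! ### Counting the maximal cliques of a Helly representation -/

/-- Sliding a common edge of finitely many paths along its line, one can reach a common edge at
which one of the paths starts a run. -/
theorem exists_common_runStart {n : ℕ} (hn : 0 < n) (Q : Fin n → GridPath) {e : Sym2 (ℤ × ℤ)}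
    (he : ∀ i, e ∈ (Q i).edgeSet) :
    ∃ e', (∀ i, e' ∈ (Q i).edgeSet) ∧ ∃ i, e' ∈ (Q i).runStarts := by
  classical
  obtain ⟨b, x, y, rfl⟩ := GridPath.exists_edgeAt_of_mem (he ⟨0, hn⟩)
  have hex : ∃ r : ℕ, ∃ i, edgeAt b (x - (r + 1)) y ∉ (Q i).edgeSet := by
    by_contra! hall
    refine Set.infinite_of_injective_forall_mem (f := fun r : ℕ => edgeAt b (x - (r + 1)) y)
      (fun r s h => ?_) (fun r => hall r ⟨0, hn⟩) (Q ⟨0, hn⟩).edgeSet_finite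
    have := edgeAt_inj.1 h
    omega
  obtain ⟨i, hi⟩ := Nat.find_spec hex
  have hmem : ∀ j, edgeAt b (x - (Nat.find hex : ℕ)) y ∈ (Q j).edgeSet := by
    intro j
    rcases Nat.eq_zero_or_pos (Nat.find hex) with h0 | hpos
    · rw [h0]
      simpa using he j
    · have := Nat.find_min hex (m := Nat.find hex - 1) (by omega)
      push Not at this
      convert this j using 2
      push_cast [Nat.cast_sub hpos]
      ring
  refine ⟨_, hmem, i, b, _, _, rfl, hmem i, ?_⟩
  convert hi using 3
  ring

/-- A Helly representation needs a run start for each of the `2 ^ n` maximal cliques, and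
the `2 * n` paths have at most `2 * k + 2` run starts each. -/
theorem two_pow_le_of_helly {n k : ℕ} (hn : 0 < n)
    (h : cocktailParty.{u} n ∈ HellyBkEPG.{u} k) : 2 ^ n ≤ 2 * n * (2 * k + 2) := by
  classical
  obtain ⟨P, hb, hd, hS⟩ := exists_edge_of_helly hn h
  choose F hF hcard using fun v : Fin n × Bool => (P v.1 v.2).exists_runStarts_subset
  have key : ∀ S : Fin n → Bool, ∃ e, (∀ i, e ∈ (P i (S i)).edgeSet) ∧
      e ∈ Finset.univ.biUnion F := by
    intro S
    obtain ⟨e, he⟩ := hS S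
    obtain ⟨e', he', i, hi⟩ := exists_common_runStart hn (fun i => P i (S i)) he
    exact ⟨e', he', Finset.mem_biUnion.2 ⟨(i, S i), Finset.mem_univ _, hF (i, S i) hi⟩⟩
  choose f hf hfF using key
  have hinj : Function.Injective f := by
    intro S T hST
    funext i
    have h1 := hf S i
    have h2 := hf T i
    rw [← hST] at h2
    have h3 : f S ∈ (P i false).edgeSet → f S ∉ (P i true).edgeSet :=
      fun h => Set.disjoint_left.1 (hd i) h
    cases hSi : S i <;> cases hTi : T i <;> simp_all
  calc 2 ^ n = (Finset.univ : Finset (Fin n → Bool)).card := by simp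
    _ ≤ (Finset.univ.biUnion F).card :=
        Finset.card_le_card_of_injOn f (fun S _ => hfF S) hinj.injOn
    _ ≤ ∑ v, (F v).card := Finset.card_biUnion_le
    _ ≤ ∑ _v : Fin n × Bool, (2 * k + 2) :=
        Finset.sum_le_sum fun v _ => (hcard v).trans (by have := hb v.1 v.2; omega)
    _ = 2 * n * (2 * k + 2) := by simp; ring

/-! ### Representations with two bends, and of the octahedron with one bend -/

/-- The path from `(0, i)` along column `0` to height `h`, across to column `1`, and along that
column to `(1, j)`, where the heights `i` and `j` are on the same side of `h`. -/
theorem exists_uPath (i h j : ℤ) (hij : (i < h ∧ j < h) ∨ (h < i ∧ h < j)) :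
    ∃ P : GridPath, P.bends ≤ 2 ∧
      (∀ x y, edgeAt true x y ∈ P.edgeSet ↔ x = 0 ∧ y = h) ∧
      ∀ x y, edgeAt false x y ∈ P.edgeSet ↔
        (y = 0 ∧ min i h ≤ x ∧ x < max i h) ∨ (y = 1 ∧ min j h ≤ x ∧ x < max j h) := by
  obtain ⟨s, a, c, hs, rfl, rfl⟩ : ∃ (s : ℤ) (a c : ℕ), ((s = 1 ∨ s = -1) ∧ 0 < a ∧ 0 < c) ∧
      h = i + s * a ∧ j = i + s * a - s * c := by
    rcases hij with hij | hij
    · exact ⟨1, (h - i).toNat, (h - j).toNat, by omega, by omega, by omega⟩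
    · exact ⟨-1, (i - h).toNat, (j - h).toNat, by omega, by omega, by omega⟩
  obtain ⟨hs, ha, hc⟩ := hs
  let p : ℕ → ℤ × ℤ := fun t =>
    if t ≤ a then (0, i + s * t) else (1, i + s * a - s * (t - a - 1))
  have p1 : ∀ t ≤ a, p t = (0, i + s * t) := fun t ht => if_pos ht
  have p2 : ∀ t, a < t → p t = (1, i + s * a - s * (t - a - 1)) := fun t ht => if_neg (by omega)
  obtain ⟨P, hL, hP⟩ := GridPath.exists_gridPath (a + 1 + c) (by omega) p
    (fun t ht => by
      rw [grid_adj_iff]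
      rcases lt_trichotomy t a with h | h | h
      · rw [p1 t h.le, p1 (t + 1) h]
        rcases hs with rfl | rfl <;> dsimp only <;> omega
      · rw [p1 t h.le, p2 (t + 1) (by omega)]
        subst h
        rcases hs with rfl | rfl <;> dsimp only <;> omega
      · rw [p2 t h, p2 (t + 1) (by omega)]
        rcases hs with rfl | rfl <;> dsimp only <;> omega)
    (fun t r ht hr htr => by
      rcases le_or_gt t a with h | h <;> rcases le_or_gt r a with h' | h'
      · rw [p1 t h, p1 r h', Prod.mk.injEq] at htr
        rcases hs with rfl | rfl <;> omega
      · rw [p1 t h, p2 r h', Prod.mk.injEq] at htr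
        omega
      · rw [p2 t h, p1 r h', Prod.mk.injEq] at htr
        omega
      · rw [p2 t h, p2 r h', Prod.mk.injEq] at htr
        rcases hs with rfl | rfl <;> omega)
  refine ⟨P, ?_, fun x y => ?_, fun x y => ?_⟩
  · -- only the edge number `a` is horizontal
    refine (Finset.card_le_card (t := {a - 1, a}) fun t ht => ?_).trans Finset.card_le_two
    rw [Finset.mem_filter, Finset.mem_range, hL] at ht
    obtain ⟨ht, hb⟩ := ht
    rw [Finset.mem_insert, Finset.mem_singleton]
    by_contra hta
    apply hb
    have hv : ∀ r < a + 1 + c, r ≠ a → P.IsVerticalEdge r := fun r hr hra => by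
      unfold GridPath.IsVerticalEdge
      rw [hP r (by omega), hP (r + 1) (by omega)]
      rcases lt_or_gt_of_ne hra with h | h
      · rw [p1 r h.le, p1 (r + 1) h]
      · rw [p2 r h, p2 (r + 1) (by omega)]
    exact iff_of_true (hv t (by omega) (by omega)) (hv (t + 1) (by omega) (by omega))
  · rw [P.mem_edgeSet_iff, hL]
    constructor
    · rintro ⟨t, ht, he⟩
      rw [hP t (by omega), hP (t + 1) (by omega), mk_eq_edgeAt_true] at he
      rcases lt_trichotomy t a with h | rfl | h
      · rw [p1 t h.le, p1 (t + 1) h] at he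
        simp only at he
        omega
      · rw [p1 t le_rfl, p2 (t + 1) (by omega)] at he
        push_cast at he
        rcases hs with rfl | rfl <;> omega
      · rw [p2 t h, p2 (t + 1) (by omega)] at he
        simp only at he
        omega
    · rintro ⟨rfl, rfl⟩
      refine ⟨a, by omega, ?_⟩
      rw [hP a (by omega), hP (a + 1) (by omega), mk_eq_edgeAt_true, p1 a le_rfl,
        p2 (a + 1) (by omega)]
      rcases hs with rfl | rfl <;> dsimp only <;> omega
  · rw [P.mem_edgeSet_iff, hL]
    constructor
    · rintro ⟨t, ht, he⟩
      rw [hP t (by omega), hP (t + 1) (by omega), mk_eq_edgeAt_false] at he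
      rcases lt_trichotomy t a with h | rfl | h
      · rw [p1 t h.le, p1 (t + 1) h] at he
        push_cast at he
        rcases hs with rfl | rfl <;> omega
      · rw [p1 t le_rfl, p2 (t + 1) (by omega)] at he
        simp only at he
        omega
      · rw [p2 t h, p2 (t + 1) (by omega)] at he
        push_cast at he
        rcases hs with rfl | rfl <;> omega
    · intro hxy
      -- the number of the edge, in each column and for each direction of travel
      obtain ⟨t, ht⟩ : ∃ t : ℕ, (y = 0 ∧ t < a ∧ ((s = 1 ∧ x = i + t) ∨ (s = -1 ∧ x = i - t - 1)))
          ∨ (y = 1 ∧ a < t ∧ t < a + 1 + c ∧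
            ((s = 1 ∧ x = i + a - (t - a - 1) - 1) ∨ (s = -1 ∧ x = i - a + (t - a - 1)))) := by
        rcases hs with rfl | rfl <;> rcases hxy with hxy | hxy
        · exact ⟨(x - i).toNat, by omega⟩
        · exact ⟨(i + 2 * a - x).toNat, by omega⟩
        · exact ⟨(i - 1 - x).toNat, by omega⟩
        · exact ⟨(x - i + 2 * a + 1).toNat, by omega⟩
      refine ⟨t, by omega, ?_⟩
      rw [hP t (by omega), hP (t + 1) (by omega), mk_eq_edgeAt_false]
      rcases ht with ht | ht
      · rw [p1 t (by omega), p1 (t + 1) (by omega)]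
        push_cast
        rcases hs with rfl | rfl <;> omega
      · rw [p2 t (by omega), p2 (t + 1) (by omega)]
        push_cast
        rcases hs with rfl | rfl <;> omega

/-- Two bends suffice for every cocktail party graph. The paths of the `i`-th couple turn at
the bottom and at the top; they touch at the height `i` in column `0` and at the height
`-i` in column `1`. So paths with different turns and different `i` share an edge of the one column
or of the other, according to which of the two has the larger `i`. -/
theorem cocktailParty_mem_BkEPG_two {n k : ℕ} (hk : 2 ≤ k) :
    cocktailParty.{u} n ∈ BkEPG.{u} k := by
  choose P hb hh hv using fun (i : Fin n) (b : Bool) =>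
    exists_uPath (i : ℕ) (if b then n else -n) (-(i : ℕ)) (by
      have := i.2
      cases b
      all_goals simp
      all_goals omega)
  refine cocktailParty_mem_BkEPG P (fun i b => (hb i b).trans hk) (fun i => ?_) ?_
  · rw [Set.disjoint_left]
    intro e h1 h2
    obtain ⟨b, x, y, rfl⟩ := GridPath.exists_edgeAt_of_mem h1
    have := i.2
    cases b
    · rw [hv] at h1 h2
      simp at h1 h2
      omega
    · rw [hh] at h1 h2
      simp at h1 h2
      omega
  · intro i j b c hij
    have := j.2
    have : (i : ℕ) < j := hij
    cases b <;> cases c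
    · exact ⟨edgeAt true 0 (-n), (hh _ _ _ _).2 (by simp), (hh _ _ _ _).2 (by simp)⟩
    · refine ⟨edgeAt false (-(j : ℕ)) 1, (hv _ _ _ _).2 ?_, (hv _ _ _ _).2 ?_⟩
      all_goals simp
      all_goals omega
    · refine ⟨edgeAt false (i : ℕ) 0, (hv _ _ _ _).2 ?_, (hv _ _ _ _).2 ?_⟩
      all_goals simp
      all_goals omega
    · exact ⟨edgeAt true 0 n, (hh _ _ _ _).2 (by simp), (hh _ _ _ _).2 (by simp)⟩

/-- The path of length two through the origin between two of its neighbours. -/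
theorem exists_path_through_origin {p q : ℤ × ℤ} (hp : grid.Adj p 0) (hq : grid.Adj 0 q)
    (hpq : p ≠ q) :
    ∃ P : GridPath, P.bends ≤ 1 ∧ P.edgeSet = {s(p, 0), s(q, 0)} := by
  refine ⟨⟨p, q, .cons hp (.cons hq .nil), ?_, by simp⟩, ?_, ?_⟩
  · simp [SimpleGraph.Walk.isPath_def, hp.ne, hq.ne, hpq]
  · exact (Finset.card_filter_le _ _).trans (by simp)
  · ext e
    simp [GridPath.edgeSet, Sym2.eq_swap (a := q)]

/-- The three couples of paths for the octahedron correspond to the three ways to split the four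
neighbours of the origin into two pairs. -/
theorem octahedron_mem_BkEPG_one : cocktailParty.{u} 3 ∈ BkEPG.{u} 1 := by
  let A : Fin 3 → Bool → ℤ × ℤ := fun i b => if b then ![(-1, 0), (0, 1), (0, 1)] i else (1, 0)
  let B : Fin 3 → Bool → ℤ × ℤ := fun i b =>
    if b then ![(0, -1), (0, -1), (-1, 0)] i else ![(0, 1), (-1, 0), (0, -1)] i
  have hA : ∀ i b, grid.Adj (A i b) 0 := by
    simp only [grid_adj_iff]
    decide
  have hB : ∀ i b, grid.Adj 0 (B i b) := by
    simp only [grid_adj_iff]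
    decide
  have hAB : ∀ i b, A i b ≠ B i b := by decide
  choose P hb hP using fun i b => exists_path_through_origin (hA i b) (hB i b) (hAB i b)
  have hmem : ∀ i b p, s(p, 0) ∈ (P i b).edgeSet ↔ p = A i b ∨ p = B i b := by
    intro i b p
    simp [hP, (hA i b).ne', (hB i b).ne]
  refine cocktailParty_mem_BkEPG P hb (fun i => ?_) fun i j b c hij => ?_
  · have h : ∀ i, A i false ≠ A i true ∧ A i false ≠ B i true ∧
        B i false ≠ A i true ∧ B i false ≠ B i true := by decide
    rw [Set.disjoint_left]
    intro e h1 h2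
    rw [hP] at h1
    rcases h1 with rfl | rfl
    · rw [hmem] at h2
      exact h2.elim (h i).1 (h i).2.1
    · rw [hmem] at h2
      exact h2.elim (h i).2.2.1 (h i).2.2.2
  · have h : ∀ i j b c, i < j → A i b = A j c ∨ A i b = B j c ∨ B i b = A j c ∨ B i b = B j c := by
      decide
    rcases h i j b c hij with h | h | h | h
    · exact ⟨s(A i b, 0), (hmem _ _ _).2 (.inl rfl), (hmem _ _ _).2 (.inl h)⟩
    · exact ⟨s(A i b, 0), (hmem _ _ _).2 (.inl rfl), (hmem _ _ _).2 (.inr h)⟩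
    · exact ⟨s(B i b, 0), (hmem _ _ _).2 (.inr rfl), (hmem _ _ _).2 (.inl h)⟩
    · exact ⟨s(B i b, 0), (hmem _ _ _).2 (.inr rfl), (hmem _ _ _).2 (.inr h)⟩

/-! ### Paths with at most one bend -/

/-- The coordinate of a point along the horizontal (`b = true`) or vertical (`b = false`)
direction. -/
def along : Bool → ℤ × ℤ → ℤ
  | true, p => p.1
  | false, p => p.2

theorem mk_eq_edgeAt {b : Bool} {p q : ℤ × ℤ} {x y : ℤ} :
    s(p, q) = edgeAt b x y ↔ along (!b) p = y ∧ along (!b) q = y ∧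
      ((along b p = x ∧ along b q = x + 1) ∨ (along b q = x ∧ along b p = x + 1)) := by
  cases b
  · exact mk_eq_edgeAt_false
  · exact mk_eq_edgeAt_true

namespace GridPath

/-- A piece of a path all of whose edges have the same direction is a segment. -/
theorem mem_straight_piece (P : GridPath) (b : Bool) {a c : ℕ} (hac : a ≤ c)
    (hc : c ≤ P.walk.length)
    (hb : ∀ t, a ≤ t → t < c →
      along (!b) (P.walk.getVert t) = along (!b) (P.walk.getVert (t + 1))) (x y : ℤ) :
    ((∃ t, a ≤ t ∧ t < c ∧ s(P.walk.getVert t, P.walk.getVert (t + 1)) = edgeAt b x y) ↔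
      y = along (!b) (P.walk.getVert a) ∧
      min (along b (P.walk.getVert a)) (along b (P.walk.getVert c)) ≤ x ∧
      x < max (along b (P.walk.getVert a)) (along b (P.walk.getVert c))) ∧
    along (!b) (P.walk.getVert c) = along (!b) (P.walk.getVert a) ∧
    ¬ ∃ t, a ≤ t ∧ t < c ∧ s(P.walk.getVert t, P.walk.getVert (t + 1)) = edgeAt (!b) x y := by
  have hline : ∀ t, a ≤ t → t ≤ c →
      along (!b) (P.walk.getVert t) = along (!b) (P.walk.getVert a) := by
    intro t hat
    induction t, hat using Nat.le_induction with
    | base => exact fun _ => rfl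
    | succ t hat ih => exact fun h => (hb t hat (by omega)).symm.trans (ih (by omega))
  obtain ⟨s, hs, hpos⟩ : ∃ s : ℤ, (s = 1 ∨ s = -1) ∧ ∀ t, a ≤ t → t ≤ c →
      along b (P.walk.getVert t) = along b (P.walk.getVert a) + s * (t - a) := by
    rcases hac.eq_or_lt with rfl | hac
    · refine ⟨1, .inl rfl, fun t h1 h2 => ?_⟩
      obtain rfl : t = a := by omega
      simp
    · have h0 := grid_adj_iff.1 (P.walk.adj_getVert_succ (i := a) (by omega))
      have h1 := hb a le_rfl hac
      refine ⟨along b (P.walk.getVert (a + 1)) - along b (P.walk.getVert a), ?_, fun t hat => ?_⟩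
      · cases b <;> simp only [along, Bool.not_true, Bool.not_false] at h1 ⊢ <;> omega
      · -- two consecutive steps are equal
        have h2 : ∀ t, a ≤ t → t < c → along b (P.walk.getVert (t + 1)) -
            along b (P.walk.getVert t) =
              along b (P.walk.getVert (a + 1)) - along b (P.walk.getVert a) := by
          intro t hat
          induction t, hat using Nat.le_induction with
          | base => exact fun _ => rfl
          | succ t hat ih =>
            intro ht
            rw [← ih (by omega)]
            have hv : P.IsVerticalEdge t ↔ P.IsVerticalEdge (t + 1) := by
              have e1 := hb t hat (by omega)
              have e2 := hb (t + 1) (by omega) ht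
              have a1 := grid_adj_iff.1 (P.walk.adj_getVert_succ (i := t) (by omega))
              have a2 := grid_adj_iff.1 (P.walk.adj_getVert_succ (i := t + 1) (by omega))
              unfold IsVerticalEdge
              cases b <;> simp only [along, Bool.not_true, Bool.not_false] at e1 e2 <;> omega
            have e := Prod.ext_iff.1 (P.getVert_add_two (by omega) hv)
            cases b
            · exact e.2
            · exact e.1
        induction t, hat using Nat.le_induction with
        | base => simp
        | succ t hat ih =>
          intro ht
          have e1 := ih (by omega)
          have e2 := h2 t hat (by omega)
          push_cast
          linarith
  have hpc := hpos c hac le_rfl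
  refine ⟨⟨?_, ?_⟩, hline c hac le_rfl, ?_⟩
  · rintro ⟨t, hat, htc, he⟩
    rw [mk_eq_edgeAt, hline t hat htc.le, hpos t hat htc.le, hpos (t + 1) (by omega) htc] at he
    push_cast at he
    rcases hs with rfl | rfl <;> omega
  · intro hxy
    obtain ⟨t, hat, htc, ht⟩ : ∃ t : ℕ, a ≤ t ∧ t < c ∧
        ((s = 1 ∧ x = along b (P.walk.getVert a) + (t - a)) ∨
          (s = -1 ∧ x = along b (P.walk.getVert a) - (t - a) - 1)) := by
      rcases hs with rfl | rfl
      · exact ⟨(x - along b (P.walk.getVert a) + a).toNat, by omega⟩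
      · exact ⟨(along b (P.walk.getVert a) - 1 - x + a).toNat, by omega⟩
    refine ⟨t, hat, htc, ?_⟩
    rw [mk_eq_edgeAt, hline t hat htc.le, hline (t + 1) (by omega) htc, hpos t hat htc.le,
      hpos (t + 1) (by omega) htc]
    push_cast
    rcases hs with rfl | rfl <;> omega
  · rintro ⟨t, hat, htc, he⟩
    rw [mk_eq_edgeAt, hline t hat htc.le, hline (t + 1) (by omega) htc] at he
    omega

/-- The edges of a path with at most one bend form an `L` with corner `(cx, cy)`: a horizontal arm
from the corner to `(hx, cy)` and a vertical arm from the corner to `(cx, vy)`. Arms may be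
empty. -/
theorem exists_corner (P : GridPath) (h : P.bends ≤ 1) :
    ∃ cx cy hx vy : ℤ, ∀ x y,
      (edgeAt true x y ∈ P.edgeSet ↔ y = cy ∧ min cx hx ≤ x ∧ x < max cx hx) ∧
      (edgeAt false x y ∈ P.edgeSet ↔ y = cx ∧ min cy vy ≤ x ∧ x < max cy vy) := by
  have hlen := P.length_pos
  -- the last edge of the first piece
  obtain ⟨m, hm, hbend⟩ : ∃ m < P.walk.length, ∀ t, t + 1 < P.walk.length →
      ((P.IsVerticalEdge t ↔ P.IsVerticalEdge (t + 1)) ↔ t ≠ m) := by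
    unfold bends at h
    rcases Finset.eq_empty_or_nonempty ((Finset.range (P.walk.length - 1)).filter
      fun i => ¬ (P.IsVerticalEdge i ↔ P.IsVerticalEdge (i + 1))) with hB | ⟨m, hm⟩
    · refine ⟨P.walk.length - 1, by omega, fun t ht => iff_of_true ?_ (by omega)⟩
      simpa using Finset.filter_eq_empty_iff.1 hB (Finset.mem_range.2 (show t < _ by omega))
    · have hm' := Finset.mem_filter.1 hm
      rw [Finset.mem_range] at hm'
      refine ⟨m, by omega, fun t ht => ?_⟩
      constructor
      · rintro h1 rfl
        exact hm'.2 h1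
      · intro hne
        by_contra hcon
        exact hne (Finset.card_le_one.1 h t
          (Finset.mem_filter.2 ⟨Finset.mem_range.2 (by omega), hcon⟩) m hm)
  have hsplit : ∀ e, e ∈ P.edgeSet ↔
      (∃ t, 0 ≤ t ∧ t < m + 1 ∧ s(P.walk.getVert t, P.walk.getVert (t + 1)) = e) ∨
      ∃ t, m + 1 ≤ t ∧ t < P.walk.length ∧ s(P.walk.getVert t, P.walk.getVert (t + 1)) = e := by
    intro e
    rw [P.mem_edgeSet_iff]
    constructor
    · rintro ⟨t, ht, he⟩
      rcases Nat.lt_or_ge t (m + 1) with h | h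
      · exact .inl ⟨t, t.zero_le, h, he⟩
      · exact .inr ⟨t, h, ht, he⟩
    · rintro (⟨t, _, ht, he⟩ | ⟨t, _, ht, he⟩)
      · exact ⟨t, by omega, he⟩
      · exact ⟨t, ht, he⟩
  have hv1 : ∀ t ≤ m, (P.IsVerticalEdge t ↔ P.IsVerticalEdge 0) := by
    intro t
    induction t with
    | zero => exact fun _ => Iff.rfl
    | succ t ih =>
      exact fun ht => ((hbend t (by omega)).2 (by omega)).symm.trans (ih (by omega))
  have hv2 : ∀ t, m + 1 ≤ t → t < P.walk.length → (P.IsVerticalEdge t ↔ ¬ P.IsVerticalEdge 0) := by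
    intro t hmt
    induction t, hmt using Nat.le_induction with
    | base =>
      intro ht
      have e1 := (hbend m ht).not
      have e2 := hv1 m le_rfl
      tauto
    | succ t hmt ih =>
      exact fun ht => ((hbend t ht).2 (by omega)).symm.trans (ih (by omega))
  have hnv : ∀ t < P.walk.length, ¬ P.IsVerticalEdge t →
      (P.walk.getVert t).2 = (P.walk.getVert (t + 1)).2 := by
    intro t ht hnot
    have := grid_adj_iff.1 (P.walk.adj_getVert_succ ht)
    unfold IsVerticalEdge at hnot
    omega
  by_cases h0 : P.IsVerticalEdge 0
  · have k1 := P.mem_straight_piece false (a := 0) (c := m + 1) (by omega) (by omega)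
      fun t _ ht => (hv1 t (by omega)).2 h0
    have k2 := P.mem_straight_piece true (a := m + 1) (c := P.walk.length) (by omega) le_rfl
      fun t hmt ht => hnv t ht fun h => (hv2 t hmt ht).1 h h0
    refine ⟨(P.walk.getVert (m + 1)).1, (P.walk.getVert (m + 1)).2,
      (P.walk.getVert P.walk.length).1, (P.walk.getVert 0).2, fun x y => ?_⟩
    obtain ⟨k1, k1', k1''⟩ := k1 x y
    obtain ⟨k2, k2', k2''⟩ := k2 x y
    simp only [along, Bool.not_true, Bool.not_false] at k1 k1' k1'' k2 k2' k2''
    rw [hsplit, hsplit, k1, k2, or_iff_right k1'', or_iff_left k2'']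
    omega
  · have k1 := P.mem_straight_piece true (a := 0) (c := m + 1) (by omega) (by omega)
      fun t _ ht => hnv t (by omega) fun h => h0 ((hv1 t (by omega)).1 h)
    have k2 := P.mem_straight_piece false (a := m + 1) (c := P.walk.length) (by omega) le_rfl
      fun t hmt ht => (hv2 t hmt ht).2 h0
    refine ⟨(P.walk.getVert (m + 1)).1, (P.walk.getVert (m + 1)).2,
      (P.walk.getVert 0).1, (P.walk.getVert P.walk.length).2, fun x y => ?_⟩
    obtain ⟨k1, k1', k1''⟩ := k1 x y
    obtain ⟨k2, k2', k2''⟩ := k2 x y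
    simp only [along, Bool.not_true, Bool.not_false] at k1 k1' k1'' k2 k2' k2''
    rw [hsplit, hsplit, k1, k2, or_iff_left k2'', or_iff_right k1'']
    omega

/-- The edges of a path with at most one bend have positions along the path, such that every
path with at most one bend meets it in an interval of positions. -/
theorem exists_position (P : GridPath) (hP : P.bends ≤ 1) :
    ∃ pos : Sym2 (ℤ × ℤ) → ℤ, ∀ Q : GridPath, Q.bends ≤ 1 →
      ∀ e ∈ P.edgeSet ∩ Q.edgeSet, ∀ f ∈ P.edgeSet ∩ Q.edgeSet, ∀ g ∈ P.edgeSet,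
        pos e ≤ pos g → pos g ≤ pos f → g ∈ Q.edgeSet := by
  obtain ⟨cx, cy, hx, vy, hc⟩ := P.exists_corner hP
  -- twice the distance of the midpoint from the corner, with opposite signs on the two arms
  let coord : Bool × ℤ × ℤ → ℤ := fun r =>
    if r.1 then |2 * r.2.1 + 1 - 2 * cx| else -|2 * r.2.1 + 1 - 2 * cy|
  have hinj : Function.Injective fun r : Bool × ℤ × ℤ => edgeAt r.1 r.2.1 r.2.2 := by
    rintro ⟨b, x, y⟩ ⟨c, z, w⟩ h
    simpa using edgeAt_inj.1 h
  have hpos : ∀ b x y, coord (Function.invFun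
      (fun r : Bool × ℤ × ℤ => edgeAt r.1 r.2.1 r.2.2) (edgeAt b x y)) = coord (b, x, y) :=
    fun b x y => congrArg coord (Function.leftInverse_invFun hinj (b, x, y))
  refine ⟨fun e =>
    coord (Function.invFun (fun r : Bool × ℤ × ℤ => edgeAt r.1 r.2.1 r.2.2) e), ?_⟩
  rintro Q hQ e ⟨he, he'⟩ f ⟨hf, hf'⟩ g hg h1 h2
  obtain ⟨dx, dy, kx, wy, hd⟩ := Q.exists_corner hQ
  obtain ⟨b, x, y, rfl⟩ := exists_edgeAt_of_mem he
  obtain ⟨c, z, w, rfl⟩ := exists_edgeAt_of_mem hf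
  obtain ⟨d, u, v, rfl⟩ := exists_edgeAt_of_mem hg
  simp only [hpos, coord] at h1 h2
  cases b <;> cases c <;> cases d <;> simp only [hc, hd] at he hf hg he' hf' ⊢ <;>
    simp only [Bool.false_eq_true, if_true, if_false] at h1 h2 <;> grind

end GridPath

/-! ### The octahedron has no Helly representation with one bend -/

/-- In a Helly representation of the octahedron with at most one bend per path, one path
would contain four edges labelled by the pairs of Booleans; each of the four sets of labels with
a fixed first or second entry would be an interval for the order along the path, which is
impossible. -/
theorem octahedron_notMem_HellyBkEPG_one : cocktailParty.{u} 3 ∉ HellyBkEPG.{u} 1 := by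
  intro h
  obtain ⟨P, hb, hd, hS⟩ := exists_edge_of_helly (by omega) h
  choose e he using fun b c : Bool => hS ![true, b, c]
  have h0 : ∀ b c, e b c ∈ (P 0 true).edgeSet := fun b c => he b c 0
  have h1 : ∀ b c, e b c ∈ (P 1 b).edgeSet := fun b c => he b c 1
  have h2 : ∀ b c, e b c ∈ (P 2 c).edgeSet := fun b c => he b c 2
  have hdis : ∀ i f b, f ∈ (P i b).edgeSet → f ∉ (P i !b).edgeSet := by
    intro i f b hf
    cases b
    · exact Set.disjoint_left.1 (hd i) hf
    · exact Set.disjoint_right.1 (hd i) hf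
  obtain ⟨pos, hpos⟩ := (P 0 true).exists_position (hb 0 true)
  have k1 : ∀ b c c' d, ¬ (pos (e b c) ≤ pos (e (!b) d) ∧ pos (e (!b) d) ≤ pos (e b c')) := by
    rintro b c c' d ⟨l1, l2⟩
    have := hpos (P 1 b) (hb 1 b) _ ⟨h0 b c, h1 b c⟩ _ ⟨h0 b c', h1 b c'⟩ _ (h0 (!b) d) l1 l2
    exact hdis 1 _ b this (h1 (!b) d)
  have k2 : ∀ c b b' d, ¬ (pos (e b c) ≤ pos (e d !c) ∧ pos (e d !c) ≤ pos (e b' c)) := by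
    rintro c b b' d ⟨l1, l2⟩
    have := hpos (P 2 c) (hb 2 c) _ ⟨h0 b c, h2 b c⟩ _ ⟨h0 b' c, h2 b' c⟩ _ (h0 d !c) l1 l2
    exact hdis 2 _ c this (h2 d !c)
  simp only [Bool.forall_bool, Bool.not_true, Bool.not_false] at k1 k2
  omega

end EPG

theorem mainTheorem8 (k : ℕ) (hk : 0 < k) :
    EPG.HellyBkEPG.{u} k ⊂ EPG.BkEPG.{u} k := by
  have hsub : EPG.HellyBkEPG.{u} k ⊆ EPG.BkEPG.{u} k := by
    rintro G ⟨R, hR, -⟩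
    exact ⟨R, hR⟩
  refine (Set.ssubset_iff_of_subset hsub).2 ?_
  rcases Nat.eq_or_lt_of_le (show 1 ≤ k from hk) with rfl | hk
  · exact ⟨_, EPG.octahedron_mem_BkEPG_one, EPG.octahedron_notMem_HellyBkEPG_one⟩
  · -- the exponential `2 ^ n` outgrows the linear bound for Helly representations
    obtain ⟨n, hn, hlt⟩ : ∃ n, 0 < n ∧ 2 * n * (2 * k + 2) < 2 ^ n := by
      have h : 8 * k + 8 < 2 ^ (8 * k + 8) := Nat.lt_two_pow_self
      refine ⟨(8 * k + 8) + (8 * k + 8), by omega, ?_⟩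
      rw [pow_add]
      nlinarith
    exact ⟨EPG.cocktailParty n, EPG.cocktailParty_mem_BkEPG_two hk,
      fun h => (EPG.two_pow_le_of_helly hn h).not_gt hlt⟩
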